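/- Let $I$ be a countable set (finite, infinite or empty). For a standard probability space $(X,\mu)$ (a standard Borel space with a probability measure, atoms allowed), let $\operatorname{Aut}_{\mathrm{mp}}(X,\mu)$ be the group of measure preserving automorphisms of $(X,\mu)$, identified when they coincide almost everywhere, with the topology in which $T_n \to T$ if and only if $\mu(T_n^{-1}(A) \,\triangle\, T^{-1}(A)) \to 0$ for every measurable $A \subset X$. A measure preserving action $\Lambda \curvearrowright (X,\mu)$ is a homomorphism $\Lambda \to \operatorname{Aut}_{\mathrm{mp}}(X,\mu)$; it is ergodic if every measurable set that is invariant up to null sets has measure $0$ or $1$. A Polish group $G$ is called a centralizer group if there exists an ergodic measure preserving action of a countable group $\Lambda$ on a standard probability space $(X,\mu)$ such that $G$ is isomorphic, as a topological group, with the centralizer of (the image of) $\Lambda$ inside $\operatorname{Aut}_{\mathrm{mp}}(X,\mu)$. (1) If $(G_i)_{i \in I}$ is a family of centralizer groups, then the product $\prod_{i\in I} G_i$, with the product topology, is a centralizer group. (2) More precisely, let $\Lambda_i \curvearrowright (X_i,\mu_i)$, $i \in I$, be ergodic measure preserving actions of countable groups on standard probability spaces, and let $e_i$ be an isomorphism of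 topological groups from a topological group $G_i$ onto the centralizer of $\Lambda_i$ in $\operatorname{Aut}_{\mathrm{mp}}(X_i,\mu_i)$. Let $(X,\mu) = \prod_{i \in I} (X_i,\mu_i)$, and let $\Gamma < \operatorname{Aut}_{\mathrm{mp}}(X,\mu)$ be the subgroup generated by all the groups $\Lambda_i$, where $\Lambda_i$ acts in the $i$-th coordinate and trivially in the others. Then $X$ is a standard Borel space, $\Gamma$ is countable and acts ergodically on $(X,\mu)$, and $$(g_i)_{i \in I} \mapsto \prod_{i\in I} e_i(g_i), \qquad \Bigl(\prod_{i \in I} e_i(g_i)\Bigr)(x) = (e_i(g_i)(x_i))_{i \in I},$$ is an isomorphism of topological groups from $\prod_{i \in I} G_i$ onto the centralizer of $\Gamma$ inside $\operatorname{Aut}_{\mathrm{mp}}(X,\mu)$. -/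

import Mathlib

open MeasureTheory

/-- Measure preserving measurable bijections of `(X, μ)`, before identification modulo null sets. -/
abbrev PreAutMP {X : Type*} [MeasurableSpace X] (μ : Measure X) :=
  {f : X ≃ᵐ X // MeasurePreserving f μ μ}

/-- Two automorphisms are identified when they coincide almost everywhere. -/
instance PreAutMP.setoid {X : Type*} [MeasurableSpace X] (μ : Measure X) :
    Setoid (PreAutMP μ) where
  r f g := (f.1 : X → X) =ᵐ[μ] g.1
  iseqv := ⟨fun _ => Filter.EventuallyEq.rfl, fun h => h.symm, fun h k => h.trans k⟩

/-- `Aut_mp(X, μ)`: the measure preserving automorphisms of `(X, μ)`, identified when they coincide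
almost everywhere. (On a standard Borel space, every measurable isomorphism between conull
measurable subsets agrees almost everywhere with a measurable bijection of the whole space.) -/
def AutMP {X : Type*} [MeasurableSpace X] (μ : Measure X) : Type _ :=
  Quotient (PreAutMP.setoid μ)

namespace AutMP

section Basic

variable {X : Type*} [MeasurableSpace X] {μ : Measure X}

/-- The class of a measure preserving measurable bijection. -/
def mk (f : X ≃ᵐ X) (hf : MeasurePreserving f μ μ) : AutMP μ :=
  Quotient.mk (PreAutMP.setoid μ) ⟨f, hf⟩

/-- A representative; it is well defined up to almost everywhere equality. -/
noncomputable def rep (T : AutMP μ) : X ≃ᵐ X :=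
  (Quotient.out T).1

theorem measurePreserving_rep (T : AutMP μ) : MeasurePreserving T.rep μ μ :=
  (Quotient.out T).2

theorem mk_rep (T : AutMP μ) : mk T.rep T.measurePreserving_rep = T :=
  Quotient.out_eq T

theorem mk_eq_mk {f g : X ≃ᵐ X} {hf : MeasurePreserving f μ μ} {hg : MeasurePreserving g μ μ} :
    mk f hf = mk g hg ↔ (f : X → X) =ᵐ[μ] g :=
  ⟨fun h => Quotient.exact h, fun h => Quotient.sound h⟩

theorem rep_mk (f : X ≃ᵐ X) (hf : MeasurePreserving f μ μ) :
    ((mk f hf).rep : X → X) =ᵐ[μ] f :=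
  mk_eq_mk.1 (mk_rep (mk f hf))

theorem symm_congr {f g : X ≃ᵐ X} (hg : MeasurePreserving g μ μ)
    (h : (f : X → X) =ᵐ[μ] g) : (f.symm : X → X) =ᵐ[μ] g.symm := by
  have h' := (hg.symm g).quasiMeasurePreserving.ae h
  filter_upwards [h'] with x hx
  rw [MeasurableEquiv.apply_symm_apply] at hx
  rw [← hx, MeasurableEquiv.symm_apply_apply, hx]

/-- The group structure: the product `S * T` is the class of the composition `S ∘ T`. -/
instance instGroup : Group (AutMP μ) where
  mul := Quotient.map₂ (fun f g => ⟨g.1.trans f.1, f.2.comp g.2⟩) (by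
    intro f f' hf g g' hg
    exact (g.2.quasiMeasurePreserving.ae_eq_comp hf).trans (hg.fun_comp f'.1))
  one := mk (MeasurableEquiv.refl X) (MeasurePreserving.id μ)
  inv := Quotient.map (fun f => ⟨f.1.symm, f.2.symm f.1⟩) (by
    intro f g h
    exact symm_congr g.2 h)
  mul_assoc := by
    rintro ⟨f⟩ ⟨g⟩ ⟨h⟩
    rfl
  one_mul := by
    rintro ⟨f⟩
    rfl
  mul_one := by
    rintro ⟨f⟩
    rfl
  inv_mul_cancel := by
    rintro ⟨f⟩
    exact mk_eq_mk.2 (Filter.Eventually.of_forall fun x => f.1.symm_apply_apply x)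

theorem measurePreserving_trans {f g : X ≃ᵐ X} (hf : MeasurePreserving f μ μ)
    (hg : MeasurePreserving g μ μ) : MeasurePreserving (g.trans f) μ μ :=
  hf.comp hg

theorem mk_mul_mk (f g : X ≃ᵐ X) (hf : MeasurePreserving f μ μ) (hg : MeasurePreserving g μ μ) :
    mk f hf * mk g hg = mk (g.trans f) (measurePreserving_trans hf hg) :=
  rfl

theorem rep_mul (S T : AutMP μ) : ((S * T).rep : X → X) =ᵐ[μ] S.rep ∘ T.rep := by
  have h : S * T = mk (T.rep.trans S.rep)
      (measurePreserving_trans S.measurePreserving_rep T.measurePreserving_rep) := by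
    rw [← mk_mul_mk _ _ S.measurePreserving_rep T.measurePreserving_rep, mk_rep, mk_rep]
  rw [h]
  exact rep_mk _ _

/-- The inverse image of a measurable set, as a point of the space of measurable sets with the
pseudometric `μ (A ∆ B)`. -/
noncomputable def preimage (T : AutMP μ) (A : MeasuredSets μ) : MeasuredSets μ :=
  ⟨T.rep ⁻¹' A.1, T.rep.measurable A.2⟩

/-- The usual (weak) topology of `Aut_mp(X, μ)`: the coarsest one for which `T ↦ T⁻¹(A)` is
continuous into the measure algebra for every measurable `A`. Thus `Tₙ → T` if and only if
`μ (Tₙ⁻¹(A) ∆ T⁻¹(A)) → 0` for all measurable `A`; since `μ` is preserved, this is the same as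
`μ (Tₙ(A) ∆ T(A)) → 0` for all measurable `A`. -/
noncomputable instance instTopologicalSpace : TopologicalSpace (AutMP μ) :=
  ⨅ A : MeasuredSets μ, TopologicalSpace.induced (fun T : AutMP μ => T.preimage A) inferInstance

/-- A measure preserving action `Λ ↷ (X, μ)`, i.e. a homomorphism `Λ → Aut_mp(X, μ)`, is ergodic if
every almost invariant measurable set is null or conull. -/
def IsErgodicAction {Λ : Type*} [Group Λ] (ρ : Λ →* AutMP μ) : Prop :=
  ∀ s : Set X, MeasurableSet s → (∀ l : Λ, (ρ l).rep ⁻¹' s =ᵐ[μ] s) → μ s = 0 ∨ μ sᶜ = 0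

end Basic

section Product

variable {I : Type*} {X : I → Type*} [∀ i, MeasurableSpace (X i)]
  (μ : ∀ i, Measure (X i)) [∀ i, IsProbabilityMeasure (μ i)]

theorem measurePreserving_piCongrRight (f : ∀ i, X i ≃ᵐ X i)
    (hf : ∀ i, MeasurePreserving (f i) (μ i) (μ i)) :
    MeasurePreserving (MeasurableEquiv.piCongrRight f)
      (Measure.infinitePi μ) (Measure.infinitePi μ) := by
  refine ⟨(MeasurableEquiv.piCongrRight f).measurable, ?_⟩
  have h := Measure.infinitePi_map_pi μ (f := fun i => (f i : X i → X i))
    (fun i => (f i).measurable)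
  simp only [(hf _).map_eq] at h
  exact h

theorem piCongrRight_congr [Countable I] {f g : ∀ i, X i ≃ᵐ X i}
    (h : ∀ i, (f i : X i → X i) =ᵐ[μ i] g i) :
    (MeasurableEquiv.piCongrRight f : (∀ i, X i) → ∀ i, X i) =ᵐ[Measure.infinitePi μ]
      MeasurableEquiv.piCongrRight g := by
  have h' : ∀ᵐ x ∂(Measure.infinitePi μ), ∀ i, f i (x i) = g i (x i) :=
    ae_all_iff.2 fun i =>
      (measurePreserving_eval_infinitePi μ i).quasiMeasurePreserving.ae (h i)
  filter_upwards [h'] with x hx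
  funext i
  exact hx i

/-- The product automorphism `∏ᵢ Tᵢ : (xᵢ)ᵢ ↦ (Tᵢ xᵢ)ᵢ` of the product probability space, as a
group homomorphism `∏ᵢ Aut_mp(Xᵢ, μᵢ) → Aut_mp(∏ᵢ (Xᵢ, μᵢ))`. -/
noncomputable def prodHom [Countable I] :
    (∀ i, AutMP (μ i)) →* AutMP (Measure.infinitePi μ) :=
  MonoidHom.mk'
    (fun T => mk (MeasurableEquiv.piCongrRight fun i => (T i).rep)
      (measurePreserving_piCongrRight μ _ fun i => (T i).measurePreserving_rep))
    (by
      intro S T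
      rw [mk_mul_mk, mk_eq_mk]
      exact piCongrRight_congr μ (g := fun i => (T i).rep.trans (S i).rep)
        fun i => rep_mul (S i) (T i))

open Classical in
/-- `Aut_mp(Xᵢ, μᵢ)` acting in the `i`-th coordinate of the product, and trivially in the others. -/
noncomputable def coordHom [Countable I] (i : I) :
    AutMP (μ i) →* AutMP (Measure.infinitePi μ) :=
  (prodHom μ).comp (MonoidHom.mulSingle (fun j => AutMP (μ j)) i)

/-- Given actions `Λᵢ ↷ (Xᵢ, μᵢ)`, the subgroup of `Aut_mp(∏ᵢ (Xᵢ, μᵢ))` generated by all the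
groups `Λᵢ`, where `Λᵢ` acts in the `i`-th coordinate. -/
noncomputable def coordSubgroup [Countable I] {Λ : I → Type*} [∀ i, Group (Λ i)]
    (ρ : ∀ i, Λ i →* AutMP (μ i)) : Subgroup (AutMP (Measure.infinitePi μ)) :=
  ⨆ i, ((coordHom μ i).comp (ρ i)).range

end Product

end AutMP

/-- A Polish group `G` is a centralizer group if there is an ergodic probability measure preserving
action of a countable group `Λ` on a standard probability space `(X, μ)` such that `G` is
isomorphic, as a topological group, with the centralizer of `Λ` inside `Aut_mp(X, μ)`.
(Every standard Borel space and every countable group has an isomorphic copy in `Type`.) -/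
def IsCentralizerGroup (G : Type*) [Group G] [TopologicalSpace G] : Prop :=
  IsTopologicalGroup G ∧ PolishSpace G ∧
    ∃ (X : Type) (_ : MeasurableSpace X) (_ : StandardBorelSpace X)
      (μ : Measure X) (_ : IsProbabilityMeasure μ)
      (Λ : Type) (_ : Group Λ) (_ : Countable Λ) (ρ : Λ →* AutMP μ),
      AutMP.IsErgodicAction ρ ∧ Nonempty (G ≃ₜ* Subgroup.centralizer (Set.range ρ))

/-! The key fact is `exists_ae_eq_eval_preimage`: if `s` is invariant under every `Λ j` with `j ≠
i`, then `s` depends only on the `i`-th coordinate. By ergodicity of `Λ j`, a finite invariant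
measure absolutely continuous with respect to `μ j` is a multiple of `μ j`. Restricting the product
measure to `s` and projecting to coordinate `j` gives such a measure, so `s` is independent of
coordinate `j`. Splitting off finitely many coordinates in this way shows that the restriction to
`s` agrees on cylinders with a measure whose density is a function of `x i` alone. Hence the
indicator of `s` is such a function.

Ergodicity of the generated group follows at once. If `T` centralizes it, then the inverse image
under `T` of a cylinder over coordinate `i` is invariant under all `Λ j`, `j ≠ i`, so the `i`-th
coordinate of `T x` is a function of `x i`. The same applied to `T⁻¹` makes these functions
invertible, and `T` is a product. The topologies match because `prodHom` is inducing
(`isInducing_prodHom`). -/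

/-! ### Countability, reindexing, and measurable maps modulo null sets -/

theorem Subgroup.countable_closure {G : Type*} [Group G] {s : Set G} (hs : s.Countable) :
    Countable (Subgroup.closure s) := by
  have : Countable s := hs
  rw [← Subtype.range_coe (s := s), ← FreeGroup.range_lift_eq_closure]
  have : Countable (FreeGroup s) := Quot.mk_surjective.countable
  exact (MonoidHom.rangeRestrict_surjective _).countable

/-- Reindexing a product of topological groups along an equivalence. -/
def ContinuousMulEquiv.piReindex {I J : Type*} (e : J ≃ I) (G : I → Type*) [∀ i, Group (G i)]
    [∀ i, TopologicalSpace (G i)] : (∀ i, G i) ≃ₜ* (∀ j, G (e j)) where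
  toEquiv := (Equiv.piCongrLeft G e).symm
  map_mul' _ _ := rfl
  continuous_toFun := (Homeomorph.piCongrLeft (Y := G) e).symm.continuous
  continuous_invFun := (Homeomorph.piCongrLeft (Y := G) e).continuous

/-- A function into a standard Borel space all of whose measurable preimages are, up to null sets,
preimages under `p`, factors through `p` almost everywhere. -/
theorem MeasureTheory.exists_measurable_ae_eq_comp {Ω Y Z : Type*} [MeasurableSpace Ω]
    [MeasurableSpace Y] [MeasurableSpace Z] [StandardBorelSpace Z] [Nonempty Z] {μ : Measure Ω}
    {p : Ω → Y} {f : Ω → Z}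
    (h : ∀ B : Set Z, MeasurableSet B → ∃ C : Set Y, MeasurableSet C ∧ f ⁻¹' B =ᵐ[μ] p ⁻¹' C) :
    ∃ g : Y → Z, Measurable g ∧ f =ᵐ[μ] g ∘ p := by
  classical
  -- Embedding `Z` in the Cantor space reduces the claim to countably many sets, one per binary
  -- digit of `f`; `ψ'` below is a measurable left inverse of `ψ`.
  obtain ⟨ψ, hψm, hψi⟩ := MeasurableSpace.measurable_injection_nat_bool_of_countablySeparated Z
  have hψ := hψm.measurableEmbedding hψi
  have hB : ∀ n, MeasurableSet {z | ψ z n = true} := fun n =>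
    measurableSet_eq_fun ((measurable_pi_apply n).comp hψm) measurable_const
  choose C hCm hC using fun n => h _ (hB n)
  obtain ⟨ψ', hψ'm, hψ'⟩ := hψ.exists_measurable_extend measurable_id (fun _ => ‹Nonempty Z›)
  refine ⟨fun y => ψ' fun n => decide (y ∈ C n), hψ'm.comp (measurable_pi_lambda _ fun n => ?_), ?_⟩
  · exact measurable_to_bool (by simpa [Set.preimage] using! hCm n)
  · have h' : ∀ᵐ x ∂μ, ∀ n, (ψ (f x) n = true ↔ p x ∈ C n) :=
      ae_all_iff.2 fun n => (hC n).mem_iff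
    filter_upwards [h'] with x hx
    have : (fun n => decide (p x ∈ C n)) = ψ (f x) := by
      funext n
      rw [Bool.eq_iff_iff, decide_eq_true_iff]
      exact (hx n).symm
    simp only [Function.comp_apply, this]
    exact (congrFun hψ' (f x)).symm

/-- Two measurable self-maps that preserve null sets and are inverse to each other almost
everywhere agree almost everywhere with a measurable bijection and its inverse. -/
theorem MeasureTheory.exists_measurableEquiv_ae_eq {Y : Type*} [MeasurableSpace Y] {μ : Measure Y}
    {g g' : Y → Y} (hg : Measure.QuasiMeasurePreserving g μ μ)
    (hg' : Measure.QuasiMeasurePreserving g' μ μ)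
    (h : ∀ᵐ y ∂μ, g' (g y) = y) (h' : ∀ᵐ y ∂μ, g (g' y) = y) :
    ∃ f : Y ≃ᵐ Y, (f : Y → Y) =ᵐ[μ] g := by
  classical
  obtain ⟨A₀, hA₀, hA₀m, hA₀s⟩ := Filter.Eventually.exists_measurable_mem (h.and h')
  -- `w` runs through all words in `g` and `g'`. The points that every word sends into `A₀` form a
  -- conull set stable under both maps, on which they are inverse to each other.
  let w : List Bool → Y → Y := fun l => l.foldr (fun b k => k ∘ (if b then g else g')) id
  have hw : ∀ l, Measure.QuasiMeasurePreserving (w l) μ μ := by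
    intro l
    induction l with
    | nil => exact Measure.QuasiMeasurePreserving.id μ
    | cons b l ih => cases b <;> simpa [w] using! ih.comp (by assumption)
  let A : Set Y := ⋂ l, w l ⁻¹' A₀
  have hAm : MeasurableSet A := MeasurableSet.iInter fun l => (hw l).measurable hA₀m
  have hA : ∀ᵐ y ∂μ, y ∈ A := by
    have : ∀ᵐ y ∂μ, ∀ l, w l y ∈ A₀ := ae_all_iff.2 fun l => (hw l).ae hA₀
    filter_upwards [this] with y hy using Set.mem_iInter.2 hy
  have hAg : ∀ y ∈ A, g y ∈ A := fun y hy =>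
    Set.mem_iInter.2 fun l => by simpa [w] using! Set.mem_iInter.1 hy (true :: l)
  have hAg' : ∀ y ∈ A, g' y ∈ A := fun y hy =>
    Set.mem_iInter.2 fun l => by simpa [w] using! Set.mem_iInter.1 hy (false :: l)
  have hAi : ∀ y ∈ A, g' (g y) = y ∧ g (g' y) = y := fun y hy =>
    hA₀s y (Set.mem_iInter.1 hy [])
  refine ⟨⟨⟨A.piecewise g id, A.piecewise g' id, fun y => ?_, fun y => ?_⟩,
    hg.measurable.piecewise hAm measurable_id, hg'.measurable.piecewise hAm measurable_id⟩, ?_⟩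
  · by_cases hy : y ∈ A <;> simp [hy, hAg, hAi]
  · by_cases hy : y ∈ A <;> simp [hy, hAg', hAi]
  · filter_upwards [hA] with y hy
    exact Set.piecewise_eq_of_mem _ _ _ hy

/-! ### Representatives and invariant measures -/

namespace AutMP

section Basic

variable {X : Type*} [MeasurableSpace X] {μ : Measure X}

theorem rep_one : ((1 : AutMP μ).rep : X → X) =ᵐ[μ] id :=
  rep_mk (MeasurableEquiv.refl X) (MeasurePreserving.id μ)

theorem ext_rep {S T : AutMP μ} (h : (S.rep : X → X) =ᵐ[μ] T.rep) : S = T := by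
  rw [← mk_rep S, ← mk_rep T, mk_eq_mk]
  exact h

theorem edist_preimage (T : AutMP μ) (A B : MeasuredSets μ) :
    edist (T.preimage A) (T.preimage B) = edist A B := by
  rw [MeasuredSets.edist_def, MeasuredSets.edist_def]
  exact T.measurePreserving_rep.measure_preimage (A.2.symmDiff B.2).nullMeasurableSet

theorem continuous_preimage (A : MeasuredSets μ) :
    Continuous fun T : AutMP μ => T.preimage A :=
  continuous_iInf_dom (i := A) continuous_induced_dom

/-- An invariant absolutely continuous finite measure of an ergodic action is a multiple of the
given measure. -/
theorem IsErgodicAction.eq_smul [IsProbabilityMeasure μ] {Λ : Type*} [Group Λ] {ρ : Λ →* AutMP μ}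
    (hρ : IsErgodicAction ρ) {ν : Measure X} [IsFiniteMeasure ν] (hν : ν ≪ μ)
    (h : ∀ l, MeasurePreserving (ρ l).rep ν ν) : ν = ν Set.univ • μ := by
  -- The density is an invariant function, so its inverse images of measurable sets are null or
  -- conull.
  obtain ⟨c, hc⟩ : ∃ c, ν.rnDeriv μ =ᵐ[μ] Function.const X c := by
    refine Filter.exists_eventuallyEq_const_of_forall_separating MeasurableSet fun U hU => ?_
    have hm := Measure.measurable_rnDeriv ν μ hU
    refine (hρ _ hm fun l => ?_).symm.imp (fun h0 => ?_) (fun h0 => ?_)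
    · filter_upwards [(h l).rnDeriv_comp_aeEq (ρ l).measurePreserving_rep] with x hx
      exact propext (by
        change ν.rnDeriv μ ((ρ l).rep x) ∈ U ↔ ν.rnDeriv μ x ∈ U
        rw [← hx, Function.comp_apply])
    · exact h0
    · exact measure_eq_zero_iff_ae_notMem.1 h0
  have key : ν = c • μ := by
    rw [← Measure.withDensity_rnDeriv_eq ν μ hν, withDensity_congr_ae hc]
    exact withDensity_const c
  have hc' : ν Set.univ = c := by rw [key]; simp
  rw [hc']
  exact key

end Basic

end AutMP

/-! ### Product automorphisms in coordinates, and independence -/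

namespace AutMP

section Product

variable {I : Type*} {X : I → Type*} [∀ i, MeasurableSpace (X i)]
  (μ : ∀ i, Measure (X i)) [∀ i, IsProbabilityMeasure (μ i)]

/-- Descends almost everywhere statements from the product to a factor. -/
theorem ae_eval_iff (i : I) {p : X i → Prop} (hp : MeasurableSet {y | p y}) :
    (∀ᵐ x ∂(Measure.infinitePi μ), p (x i)) ↔ ∀ᵐ y ∂(μ i), p y := by
  rw [← (measurePreserving_eval_infinitePi μ i).map_eq,
    ae_map_iff (measurable_pi_apply i).aemeasurable hp]

variable [Countable I]

theorem prodHom_rep (T : ∀ i, AutMP (μ i)) :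
    ∀ᵐ x ∂(Measure.infinitePi μ), ∀ i, (prodHom μ T).rep x i = (T i).rep (x i) := by
  have h := rep_mk (MeasurableEquiv.piCongrRight fun i => (T i).rep)
    (measurePreserving_piCongrRight μ _ fun i => (T i).measurePreserving_rep)
  filter_upwards [h] with x hx i
  exact congrFun hx i

theorem coordHom_apply [DecidableEq I] (i : I) (S : AutMP (μ i)) :
    coordHom μ i S = prodHom μ (Pi.mulSingle i S) := by
  simp only [coordHom, MonoidHom.comp_apply, MonoidHom.mulSingle_apply]
  congr!

theorem coordHom_rep_self (i : I) (S : AutMP (μ i)) :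
    ∀ᵐ x ∂(Measure.infinitePi μ), (coordHom μ i S).rep x i = S.rep (x i) := by
  classical
  rw [coordHom_apply]
  filter_upwards [prodHom_rep μ (Pi.mulSingle i S)] with x hx
  rw [hx i, Pi.mulSingle_eq_same]

theorem coordHom_rep_of_ne {i j : I} (hij : j ≠ i) (S : AutMP (μ i)) :
    ∀ᵐ x ∂(Measure.infinitePi μ), (coordHom μ i S).rep x j = x j := by
  classical
  rw [coordHom_apply]
  filter_upwards [prodHom_rep μ (Pi.mulSingle i S),
    (measurePreserving_eval_infinitePi μ j).quasiMeasurePreserving.ae rep_one] with x hx hx'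
  rw [hx j, Pi.mulSingle_eq_of_ne hij]
  exact hx'

theorem prodHom_injective [∀ i, StandardBorelSpace (X i)] :
    Function.Injective (prodHom μ) := by
  intro S T h
  funext i
  refine ext_rep ((ae_eval_iff μ i (measurableSet_eq_fun (S i).rep.measurable
    (T i).rep.measurable)).1 ?_)
  filter_upwards [prodHom_rep μ S, prodHom_rep μ T] with x hS hT
  rw [← hS i, ← hT i, h]

/-! ### Sets invariant in some of the coordinates -/

variable {Λ : I → Type*} [∀ i, Group (Λ i)] (ρ : ∀ i, Λ i →* AutMP (μ i))

/-- Almost everywhere invariance of a subset of the product under `Λ i`, acting in the `i`-th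
coordinate. -/
def CoordInvariant (i : I) (s : Set (∀ i, X i)) : Prop :=
  ∀ l : Λ i, (coordHom μ i (ρ i l)).rep ⁻¹' s =ᵐ[Measure.infinitePi μ] s

variable {μ ρ}

theorem CoordInvariant.inter {i : I} {s t : Set (∀ i, X i)} (hs : CoordInvariant μ ρ i s)
    (ht : CoordInvariant μ ρ i t) : CoordInvariant μ ρ i (s ∩ t) := fun l =>
  (hs l).inter (ht l)

theorem coordInvariant_eval_preimage {i j : I} (hij : j ≠ i) (B : Set (X j)) :
    CoordInvariant μ ρ i (Function.eval j ⁻¹' B) := fun l => by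
  filter_upwards [coordHom_rep_of_ne μ hij (ρ i l)] with x hx
  refine propext ?_
  change (coordHom μ i (ρ i l)).rep x j ∈ B ↔ x j ∈ B
  rw [hx]

theorem coordInvariant_pi {i : I} {F : Finset I} (hF : i ∉ F) (t : ∀ j, Set (X j)) :
    CoordInvariant μ ρ i ((F : Set I).pi t) := fun l => by
  have h : ∀ᵐ x ∂(Measure.infinitePi μ), ∀ j, j ≠ i → (coordHom μ i (ρ i l)).rep x j = x j := by
    refine ae_all_iff.2 fun j => ?_
    by_cases hj : j = i
    · exact .of_forall fun x h => absurd hj h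
    · filter_upwards [coordHom_rep_of_ne μ hj (ρ i l)] with x hx _ using hx
  filter_upwards [h] with x hx
  refine propext (forall₂_congr fun j hj => ?_)
  rw [hx j (by rintro rfl; exact hF hj)]

/-- An invariant set in the direction of an ergodic coordinate is independent of this coordinate. -/
theorem CoordInvariant.map_restrict {i : I} {s : Set (∀ i, X i)} (hs : CoordInvariant μ ρ i s)
    (hsm : MeasurableSet s) (hρ : IsErgodicAction (ρ i)) :
    ((Measure.infinitePi μ).restrict s).map (Function.eval i) =
      Measure.infinitePi μ s • μ i := by
  have hm : Measurable (Function.eval i : (∀ i, X i) → X i) := measurable_pi_apply i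
  have hν : ((Measure.infinitePi μ).restrict s).map (Function.eval i) ≪ μ i := by
    conv_rhs => rw [← (measurePreserving_eval_infinitePi μ i).map_eq]
    exact (Measure.absolutelyContinuous_of_le Measure.restrict_le_self).map hm
  refine (hρ.eq_smul hν fun l => ⟨(ρ i l).rep.measurable, ?_⟩).trans ?_
  -- The restriction to `s` is preserved by `Λ i` acting on the product, and the projection to
  -- coordinate `i` intertwines this action with the one on `X i`.
  · have hc := ((coordHom μ i (ρ i l)).measurePreserving_rep.restrict_preimage hsm).map_eq
    rw [Measure.restrict_congr_set (hs l)] at hc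
    rw [Measure.map_map (ρ i l).rep.measurable hm]
    conv_rhs => rw [← hc, Measure.map_map hm (coordHom μ i (ρ i l)).rep.measurable]
    refine Measure.map_congr (ae_restrict_of_ae ?_)
    filter_upwards [coordHom_rep_self μ i (ρ i l)] with x hx using hx.symm
  · rw [Measure.map_apply hm .univ]
    simp

theorem CoordInvariant.measure_inter_eval_preimage {i : I} {s : Set (∀ i, X i)}
    (hs : CoordInvariant μ ρ i s) (hsm : MeasurableSet s) (hρ : IsErgodicAction (ρ i))
    {B : Set (X i)} (hB : MeasurableSet B) :
    Measure.infinitePi μ (s ∩ Function.eval i ⁻¹' B) = Measure.infinitePi μ s * μ i B := by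
  have h := congrArg (fun ν => ν B) (hs.map_restrict hsm hρ)
  have hm : Measurable (Function.eval i : (∀ i, X i) → X i) := measurable_pi_apply i
  simp only [Measure.map_apply hm hB, Measure.restrict_apply (hm hB), Measure.smul_apply,
    smul_eq_mul] at h
  rw [Set.inter_comm, h]

/-- Intersecting with a cylinder over other coordinates keeps invariance in a new direction, so the
coordinates split off one at a time. -/
theorem measure_inter_pi_of_coordInvariant (hρ : ∀ i, IsErgodicAction (ρ i))
    {s : Set (∀ i, X i)} (hsm : MeasurableSet s) {F : Finset I}
    (hs : ∀ i ∈ F, CoordInvariant μ ρ i s) {t : ∀ i, Set (X i)} (ht : ∀ i, MeasurableSet (t i)) :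
    Measure.infinitePi μ (s ∩ (F : Set I).pi t) =
      Measure.infinitePi μ s * ∏ i ∈ F, μ i (t i) := by
  classical
  induction F using Finset.induction_on with
  | empty => simp
  | insert i F hi ih =>
    have hpi : MeasurableSet ((F : Set I).pi t) :=
      MeasurableSet.pi F.countable_toSet fun j _ => ht j
    rw [Finset.coe_insert, Set.insert_pi, Set.inter_comm (_ ⁻¹' _), ← Set.inter_assoc,
      ((hs i (by simp)).inter (coordInvariant_pi hi t)).measure_inter_eval_preimage
        (hsm.inter hpi) (hρ i) (ht i),
      ih fun j hj => hs j (by simp [hj]), Finset.prod_insert hi]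
    ring

/-- A set that is invariant in the direction of all coordinates but one depends, up to a null set,
only on this coordinate. -/
theorem exists_ae_eq_eval_preimage (hρ : ∀ i, IsErgodicAction (ρ i)) {i : I}
    {s : Set (∀ i, X i)} (hsm : MeasurableSet s) (hs : ∀ j, j ≠ i → CoordInvariant μ ρ j s) :
    ∃ C : Set (X i), MeasurableSet C ∧
      s =ᵐ[Measure.infinitePi μ] Function.eval i ⁻¹' C := by
  classical
  have hm : Measurable (Function.eval i : (∀ i, X i) → X i) := measurable_pi_apply i
  let ν := ((Measure.infinitePi μ).restrict s).map (Function.eval i)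
  have hν : ν ≪ μ i := by
    rw [← (measurePreserving_eval_infinitePi μ i).map_eq]
    exact (Measure.absolutelyContinuous_of_le Measure.restrict_le_self).map hm
  let h := ν.rnDeriv (μ i)
  have hh : Measurable h := Measure.measurable_rnDeriv _ _
  have hhm : Measurable (h ∘ (Function.eval i : (∀ i, X i) → X i)) := hh.comp hm
  have hpi : ∀ (F : Finset I) (t : ∀ j, Set (X j)), (∀ j, MeasurableSet (t j)) → i ∉ F →
      ∀ B, MeasurableSet B →
      (Measure.infinitePi μ).restrict s (Function.eval i ⁻¹' B ∩ (F : Set I).pi t) =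
      (Measure.infinitePi μ).withDensity (h ∘ Function.eval i)
        (Function.eval i ⁻¹' B ∩ (F : Set I).pi t) := by
    intro F t ht hi B hB
    have hFm : MeasurableSet ((F : Set I).pi t) :=
      MeasurableSet.pi F.countable_toSet fun j _ => ht j
    have h1 : Measure.infinitePi μ ((s ∩ Function.eval i ⁻¹' B) ∩ (F : Set I).pi t) =
        ν B * ∏ j ∈ F, μ j (t j) := by
      rw [measure_inter_pi_of_coordInvariant hρ (hsm.inter (hm hB)) (fun j hj => ?_) ht,
        Measure.map_apply hm hB, Measure.restrict_apply (hm hB), Set.inter_comm s]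
      have hj' : j ≠ i := by rintro rfl; exact hi hj
      exact (hs j hj').inter (coordInvariant_eval_preimage hj'.symm B)
    -- A box over coordinates other than `i` is trivially invariant in direction `i`, so the
    -- independence lemma also applies to it.
    have h2 : ((Measure.infinitePi μ).restrict ((F : Set I).pi t)).map (Function.eval i) =
        (∏ j ∈ F, μ j (t j)) • μ i := by
      rw [(coordInvariant_pi (ρ := ρ) hi t).map_restrict hFm (hρ i),
        Measure.infinitePi_pi μ fun j _ => ht j]
    rw [Measure.restrict_apply ((hm hB).inter hFm), Set.inter_comm, ← Set.inter_assoc, h1,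
      withDensity_apply _ ((hm hB).inter hFm), ← Measure.restrict_restrict (hm hB)]
    change _ = ∫⁻ x in Function.eval i ⁻¹' B, h (Function.eval i x) ∂_
    rw [← setLIntegral_map hB hh hm, h2, Measure.restrict_smul, lintegral_smul_measure,
      smul_eq_mul, mul_comm, Measure.setLIntegral_rnDeriv hν]
  have heq : (Measure.infinitePi μ).restrict s =
      (Measure.infinitePi μ).withDensity (h ∘ Function.eval i) := by
    refine ext_of_generate_finite _ generateFrom_squareCylinders.symm
      (isPiSystem_squareCylinders (fun _ => MeasurableSpace.isPiSystem_measurableSet)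
        fun _ => MeasurableSet.univ) ?_ ?_
    · rintro _ ⟨F, t, ht, rfl⟩
      have ht' : ∀ j, MeasurableSet (t j) := fun j => ht j (Set.mem_univ j)
      by_cases hi : i ∈ F
      · have := hpi (F.erase i) t ht' (by simp) (t i) (ht' i)
        rwa [← Set.insert_pi, ← Finset.coe_insert, Finset.insert_erase hi] at this
      · simpa using! hpi F t ht' hi Set.univ .univ
    · simpa using! hpi ∅ (fun _ => Set.univ) (fun _ => .univ) (by simp) Set.univ .univ
  rw [← withDensity_indicator_one hsm, withDensity_eq_iff
    ((measurable_one.indicator hsm).aemeasurable) hhm.aemeasurable (by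
      rw [lintegral_indicator_one hsm]; exact measure_ne_top _ _)] at heq
  -- The density coincides with the indicator of `s`, hence takes only the values 0 and 1 almost
  -- everywhere.
  refine ⟨h ⁻¹' {1}, hh (measurableSet_singleton _), ?_⟩
  filter_upwards [heq] with x hx
  refine propext ?_
  change x ∈ s ↔ h (Function.eval i x) = 1
  rw [Function.comp_apply] at hx
  rw [← hx]
  by_cases hxs : x ∈ s <;> simp [hxs]

end Product

end AutMP

/-- Transfers continuity between maps into different measure algebras, or from a set to its
complement, where only distances can be compared. -/
theorem continuous_of_edist_eq {Z α β : Type*} [TopologicalSpace Z] [PseudoEMetricSpace α]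
    [PseudoEMetricSpace β] {f : Z → α} {g : Z → β} (hf : Continuous f)
    (h : ∀ x y, edist (g x) (g y) = edist (f x) (f y)) : Continuous g := by
  refine continuous_iff_continuousAt.2 fun x => EMetric.tendsto_nhds.2 fun ε hε => ?_
  filter_upwards [EMetric.tendsto_nhds.1 (hf.tendsto x) ε hε] with y hy
  rwa [h]

namespace AutMP

section Product

variable {I : Type*} [Countable I] {X : I → Type*} [∀ i, MeasurableSpace (X i)]
  (μ : ∀ i, Measure (X i)) [∀ i, IsProbabilityMeasure (μ i)]

/-! ### The topology -/

/-- The cylinder set given by a measurable subset of one coordinate. -/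
def evalPreimage {μ : ∀ i, Measure (X i)} [∀ i, IsProbabilityMeasure (μ i)] (i : I)
    (B : MeasuredSets (μ i)) : MeasuredSets (Measure.infinitePi μ) :=
  ⟨Function.eval i ⁻¹' B.1, measurable_pi_apply i B.2⟩

theorem edist_prodHom_preimage_evalPreimage (S T : ∀ i, AutMP (μ i)) (i : I)
    (B : MeasuredSets (μ i)) :
    edist ((prodHom μ S).preimage (evalPreimage i B)) ((prodHom μ T).preimage (evalPreimage i B)) =
      edist ((S i).preimage B) ((T i).preimage B) := by
  have key : ∀ S : ∀ i, AutMP (μ i),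
      ((prodHom μ S).preimage (evalPreimage i B)).1 =ᵐ[Measure.infinitePi μ]
        Function.eval i ⁻¹' ((S i).preimage B).1 := fun S => by
    filter_upwards [prodHom_rep μ S] with x hx
    refine propext ?_
    change (prodHom μ S).rep x i ∈ B.1 ↔ (S i).rep (x i) ∈ B.1
    rw [hx i]
  rw [MeasuredSets.edist_def, MeasuredSets.edist_def]
  refine (measure_congr ((key S).symmDiff (key T))).trans ?_
  exact (measurePreserving_eval_infinitePi μ i).measure_preimage
    (((S i).preimage B).2.symmDiff ((T i).preimage B).2).nullMeasurableSet

theorem continuous_prodHom_preimage (A : MeasuredSets (Measure.infinitePi μ)) :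
    Continuous fun T : ∀ i, AutMP (μ i) => (prodHom μ T).preimage A := by
  -- The sets with continuous orbit map form a σ-algebra; it suffices that it contains the
  -- one-coordinate cylinders.
  let P : Set (∀ i, X i) → Prop := fun A => ∃ hA : MeasurableSet A,
    Continuous fun T : ∀ i, AutMP (μ i) => (prodHom μ T).preimage ⟨A, hA⟩
  have hempty : P ∅ := ⟨.empty,
    continuous_const (y := (show MeasuredSets (Measure.infinitePi μ) from ⟨∅, .empty⟩))⟩
  have hcompl : ∀ A, P A → P Aᶜ := by
    rintro A ⟨hA, h⟩
    refine ⟨hA.compl, continuous_of_edist_eq h fun S T => ?_⟩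
    rw [MeasuredSets.edist_def, MeasuredSets.edist_def]
    exact congrArg _ (compl_symmDiff_compl _ _)
  have hunion : ∀ A B, P A → P B → P (A ∪ B) := by
    rintro A B ⟨hA, h⟩ ⟨hB, h'⟩
    refine ⟨hA.union hB, continuous_iff_continuousAt.2 fun S =>
      EMetric.tendsto_nhds.2 fun ε hε => ?_⟩
    filter_upwards [EMetric.tendsto_nhds.1 (h.tendsto S) _ (ENNReal.half_pos hε.ne'),
      EMetric.tendsto_nhds.1 (h'.tendsto S) _ (ENNReal.half_pos hε.ne')] with T hT hT'
    refine lt_of_le_of_lt ?_ ((ENNReal.add_lt_add hT hT').trans_eq (ENNReal.add_halves ε))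
    rw [MeasuredSets.edist_def, MeasuredSets.edist_def, MeasuredSets.edist_def]
    refine (measure_mono ?_).trans (measure_union_le _ _)
    exact Set.union_symmDiff_union_subset
  have hiUnion : ∀ f : ℕ → Set (∀ i, X i), (∀ n, P (f n)) → P (⋃ n, f n) := by
    intro f hf
    have hacc : ∀ n, P (Set.accumulate f n) := by
      intro n
      induction n with
      | zero => simpa using hf 0
      | succ n ih => rw [Set.accumulate_succ]; exact hunion _ _ ih (hf _)
    have hm : MeasurableSet (⋃ n, f n) := .iUnion fun n => (hf n).1
    refine ⟨hm, ?_⟩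
    have hlim : Filter.Tendsto
        (fun n => Measure.infinitePi μ ((⋃ n, f n) \ Set.accumulate f n)) Filter.atTop (nhds 0) := by
      have h0 : ⋂ n, (⋃ n, f n) \ Set.accumulate f n = ∅ := by
        rw [← Set.sdiff_iUnion, Set.iUnion_accumulate, Set.sdiff_self]
      rw [← measure_empty (μ := Measure.infinitePi μ), ← h0]
      exact tendsto_measure_iInter_atTop
        (fun n => (hm.diff (hacc n).1).nullMeasurableSet)
        (fun m n hmn => Set.sdiff_subset_sdiff_right (Set.monotone_accumulate hmn))
        ⟨0, measure_ne_top _ _⟩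
    -- Automorphisms act isometrically on the measure algebra, so the error of the partial unions
    -- does not depend on `T`.
    refine TendstoUniformly.continuous
      (F := fun n (T : ∀ i, AutMP (μ i)) => (prodHom μ T).preimage ⟨_, (hacc n).1⟩)
      (p := Filter.atTop) (EMetric.tendstoUniformly_iff.2 fun ε hε => ?_)
      (Filter.Frequently.of_forall fun n => (hacc n).2)
    filter_upwards [hlim.eventually_lt_const hε] with n hn T
    refine ((edist_preimage _ _ _).trans ?_).trans_lt hn
    exact congrArg (Measure.infinitePi μ) (symmDiff_of_ge (Set.accumulate_subset_iUnion n))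
  let m : MeasurableSpace (∀ i, X i) := ⟨P, hempty, hcompl, hiUnion⟩
  have hle : MeasurableSpace.pi ≤ m := by
    refine iSup_le fun i => ?_
    rintro _ ⟨B, hB, rfl⟩
    refine ⟨measurable_pi_apply i hB, continuous_of_edist_eq
      ((continuous_preimage (⟨B, hB⟩ : MeasuredSets (μ i))).comp (continuous_apply i))
      fun S T => ?_⟩
    exact edist_prodHom_preimage_evalPreimage μ S T i ⟨B, hB⟩
  exact (hle A.1 A.2).2

/-- Continuity is `continuous_prodHom_preimage`. Conversely, evaluating on cylinders over coordinate
`i` recovers the topology of the `i`-th factor isometrically. -/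
theorem isInducing_prodHom : Topology.IsInducing (prodHom μ) := by
  refine ⟨le_antisymm ?_ ?_⟩
  · refine continuous_iff_le_induced.1 (continuous_iInf_rng.2 fun A => continuous_induced_rng.2 ?_)
    exact continuous_prodHom_preimage μ A
  · refine le_iInf fun i => ?_
    let := TopologicalSpace.induced (prodHom μ) inferInstance
    refine continuous_iff_le_induced.1 (continuous_iInf_rng.2 fun B => continuous_induced_rng.2 ?_)
    exact continuous_of_edist_eq
      ((continuous_preimage (evalPreimage i B)).comp continuous_induced_dom)
      fun S T => (edist_prodHom_preimage_evalPreimage μ S T i B).symm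

end Product
end AutMP

/-! ### The group generated by the coordinate actions -/

namespace AutMP

section Product

variable {I : Type*} [Countable I] {X : I → Type*} [∀ i, MeasurableSpace (X i)]
  {μ : ∀ i, Measure (X i)} [∀ i, IsProbabilityMeasure (μ i)]
  {Λ : I → Type*} [∀ i, Group (Λ i)] {ρ : ∀ i, Λ i →* AutMP (μ i)}

theorem coordHom_mem_coordSubgroup (i : I) (l : Λ i) :
    coordHom μ i (ρ i l) ∈ coordSubgroup μ ρ :=
  Subgroup.mem_iSup_of_mem i ⟨l, rfl⟩

theorem coordSubgroup_eq_closure :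
    coordSubgroup μ ρ = Subgroup.closure (⋃ i, Set.range fun l => coordHom μ i (ρ i l)) :=
  Subgroup.iSup_eq_closure _

theorem countable_coordSubgroup [∀ i, Countable (Λ i)] : Countable (coordSubgroup μ ρ) := by
  rw [coordSubgroup_eq_closure]
  exact Subgroup.countable_closure (Set.countable_iUnion fun i => Set.countable_range _)

theorem mem_centralizer_coordSubgroup {T : AutMP (Measure.infinitePi μ)} :
    T ∈ Subgroup.centralizer (coordSubgroup μ ρ : Set (AutMP (Measure.infinitePi μ))) ↔
      ∀ i l, coordHom μ i (ρ i l) * T = T * coordHom μ i (ρ i l) := by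
  rw [coordSubgroup_eq_closure, Subgroup.centralizer_closure, Subgroup.mem_centralizer_iff]
  simp only [Set.mem_iUnion, Set.mem_range]
  exact ⟨fun h i l => h _ ⟨i, l, rfl⟩, by rintro h _ ⟨i, l, rfl⟩; exact h i l⟩

theorem prodHom_mem_centralizer_iff [∀ i, StandardBorelSpace (X i)] {S : ∀ i, AutMP (μ i)} :
    prodHom μ S ∈
        Subgroup.centralizer (coordSubgroup μ ρ : Set (AutMP (Measure.infinitePi μ))) ↔
      ∀ i, S i ∈ Subgroup.centralizer (Set.range (ρ i)) := by
  classical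
  rw [mem_centralizer_coordSubgroup]
  refine forall_congr' fun i => ?_
  rw [Subgroup.mem_centralizer_iff, Set.forall_mem_range]
  refine forall_congr' fun l => ?_
  rw [coordHom_apply, ← map_mul, ← map_mul, (prodHom_injective μ).eq_iff]
  refine ⟨fun h => by simpa using congrFun h i, fun h => ?_⟩
  funext j
  by_cases hj : j = i
  · subst hj
    simpa using h
  · simp [Pi.mulSingle_eq_of_ne hj]

theorem isErgodicAction_coordSubgroup (hρ : ∀ i, IsErgodicAction (ρ i)) :
    IsErgodicAction (coordSubgroup μ ρ).subtype := by
  intro s hs h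
  have hinv : ∀ i, CoordInvariant μ ρ i s := fun i l =>
    h ⟨_, coordHom_mem_coordSubgroup i l⟩
  obtain hI | ⟨⟨i⟩⟩ := isEmpty_or_nonempty I
  -- The empty product is a single point.
  · obtain rfl | rfl := s.eq_empty_or_nonempty.imp_right fun h =>
      Subsingleton.eq_univ_of_nonempty h <;> simp
  obtain ⟨C, hC, hsC⟩ := exists_ae_eq_eval_preimage hρ hs fun j (_ : j ≠ i) => hinv j
  have hp := measurePreserving_eval_infinitePi μ i
  have hCinv : ∀ l, (ρ i l).rep ⁻¹' C =ᵐ[μ i] C := fun l => by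
    have hm : MeasurableSet {y | (ρ i l).rep y ∈ C ↔ y ∈ C} :=
      ((ρ i l).rep.measurable hC).iff hC
    have := (ae_eval_iff μ i hm).1 (by
      filter_upwards [(hinv i l).mem_iff, hsC.mem_iff, coordHom_rep_self μ i (ρ i l),
        (coordHom μ i (ρ i l)).measurePreserving_rep.quasiMeasurePreserving.ae hsC.mem_iff]
        with x h1 h2 h3 h4
      simp only [Set.mem_preimage, Function.eval] at h1 h2 h4
      rw [← h3, ← h4, h1, h2])
    filter_upwards [this] with y hy using propext hy
  refine (hρ i C hC hCinv).imp (fun h0 => ?_) (fun h0 => ?_)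
  · rw [measure_congr hsC, hp.measure_preimage hC.nullMeasurableSet, h0]
  · rw [measure_congr hsC.compl, ← Set.preimage_compl,
      hp.measure_preimage hC.compl.nullMeasurableSet, h0]

/-! ### The centralizer -/

/-- The coordinates of an element of the centralizer depend on the same coordinate only. -/
theorem exists_measurePreserving_of_mem_centralizer [∀ i, StandardBorelSpace (X i)]
    (hρ : ∀ i, IsErgodicAction (ρ i)) {T : AutMP (Measure.infinitePi μ)}
    (hT : T ∈ Subgroup.centralizer (coordSubgroup μ ρ : Set (AutMP (Measure.infinitePi μ))))
    (i : I) : ∃ g : X i → X i, MeasurePreserving g (μ i) (μ i) ∧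
      ∀ᵐ x ∂(Measure.infinitePi μ), T.rep x i = g (x i) := by
  rw [mem_centralizer_coordSubgroup] at hT
  have : Nonempty (X i) := nonempty_of_isProbabilityMeasure (μ i)
  have hp := measurePreserving_eval_infinitePi μ i
  obtain ⟨g, hg, hgT⟩ := exists_measurable_ae_eq_comp (μ := Measure.infinitePi μ)
      (p := Function.eval i) (f := Function.eval i ∘ T.rep) fun B hB => by
    -- `T` commutes with `Λ j`, which does not move coordinate `i`; so the set is invariant in every
    -- direction `j ≠ i`.
    refine exists_ae_eq_eval_preimage hρ (hp.measurable.comp T.rep.measurable hB) fun j hj l => ?_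
    have hc := rep_mul T (coordHom μ j (ρ j l))
    rw [← hT j l] at hc
    filter_upwards [hc, rep_mul (coordHom μ j (ρ j l)) T,
      T.measurePreserving_rep.quasiMeasurePreserving.ae (coordHom_rep_of_ne μ hj.symm (ρ j l))]
      with x h1 h2 h3
    refine propext ?_
    change T.rep ((coordHom μ j (ρ j l)).rep x) i ∈ B ↔ T.rep x i ∈ B
    rw [← h3, ← Function.comp_apply (f := T.rep), ← h1, h2, Function.comp_apply]
  refine ⟨g, ⟨hg, ?_⟩, hgT⟩
  conv_lhs => rw [← hp.map_eq]
  rw [Measure.map_map hg hp.measurable, ← Measure.map_congr hgT,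
    (hp.comp T.measurePreserving_rep).map_eq]

theorem rep_inv_rep {Ω : Type*} [MeasurableSpace Ω] {κ : Measure Ω} (T : AutMP κ) :
    ∀ᵐ x ∂κ, T⁻¹.rep (T.rep x) = x := by
  have h := rep_mul T⁻¹ T
  rw [inv_mul_cancel] at h
  filter_upwards [h, rep_one (μ := κ)] with x h1 h2
  exact h1.symm.trans h2

theorem mem_range_prodHom_of_mem_centralizer [∀ i, StandardBorelSpace (X i)]
    (hρ : ∀ i, IsErgodicAction (ρ i)) {T : AutMP (Measure.infinitePi μ)}
    (hT : T ∈ Subgroup.centralizer (coordSubgroup μ ρ : Set (AutMP (Measure.infinitePi μ)))) :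
    ∃ S : ∀ i, AutMP (μ i), prodHom μ S = T := by
  choose g hg hgT using exists_measurePreserving_of_mem_centralizer hρ hT
  choose g' hg' hgT' using exists_measurePreserving_of_mem_centralizer hρ (inv_mem hT)
  have hinv : ∀ i, ∀ᵐ y ∂(μ i), g' i (g i y) = y := fun i => by
    refine (ae_eval_iff μ i (measurableSet_eq_fun
      ((hg' i).measurable.comp (hg i).measurable) measurable_id)).1 ?_
    filter_upwards [hgT i, T.measurePreserving_rep.quasiMeasurePreserving.ae (hgT' i),
      rep_inv_rep T] with x h1 h2 h3
    simp only [Function.comp_apply, id]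
    rw [← h1, ← h2, h3]
  have hinv' : ∀ i, ∀ᵐ y ∂(μ i), g i (g' i y) = y := fun i => by
    refine (ae_eval_iff μ i (measurableSet_eq_fun
      ((hg i).measurable.comp (hg' i).measurable) measurable_id)).1 ?_
    filter_upwards [hgT' i, T⁻¹.measurePreserving_rep.quasiMeasurePreserving.ae (hgT i),
      rep_inv_rep T⁻¹] with x h1 h2 h3
    rw [inv_inv] at h3
    simp only [Function.comp_apply, id]
    rw [← h1, ← h2, h3]
  choose f hf using fun i => exists_measurableEquiv_ae_eq (hg i).quasiMeasurePreserving
    (hg' i).quasiMeasurePreserving (hinv i) (hinv' i)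
  have hfm : ∀ i, MeasurePreserving (f i) (μ i) (μ i) := fun i =>
    ⟨(f i).measurable, (Measure.map_congr (hf i)).trans (hg i).map_eq⟩
  refine ⟨fun i => mk (f i) (hfm i), ext_rep ?_⟩
  have h1 : ∀ᵐ x ∂(Measure.infinitePi μ), ∀ i, (mk (f i) (hfm i)).rep (x i) = g i (x i) :=
    ae_all_iff.2 fun i => (measurePreserving_eval_infinitePi μ i).quasiMeasurePreserving.ae
      ((rep_mk (f i) (hfm i)).trans (hf i))
  filter_upwards [prodHom_rep μ fun i => mk (f i) (hfm i), h1, ae_all_iff.2 hgT] with x h1 h2 h3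
  funext i
  rw [h1, h2, h3]

/-- The product of the centralizers of ergodic actions is the centralizer of the group generated
by these actions in the coordinates of the product space. -/
theorem exists_continuousMulEquiv_centralizer [∀ i, StandardBorelSpace (X i)]
    (hρ : ∀ i, IsErgodicAction (ρ i)) {G : I → Type*} [∀ i, Group (G i)]
    [∀ i, TopologicalSpace (G i)] (e : ∀ i, G i ≃ₜ* Subgroup.centralizer (Set.range (ρ i))) :
    ∃ E : (∀ i, G i) ≃ₜ*
        Subgroup.centralizer (coordSubgroup μ ρ : Set (AutMP (Measure.infinitePi μ))),
      ∀ g : ∀ i, G i, (E g : AutMP (Measure.infinitePi μ)) =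
        prodHom μ (fun i => (e i (g i) : AutMP (μ i))) := by
  let φ : (∀ i, G i) →* ∀ i, AutMP (μ i) := MonoidHom.piMap fun i =>
    (Subgroup.subtype _).comp (e i).toMulEquiv.toMonoidHom
  have hφ : Topology.IsInducing φ :=
    Topology.IsInducing.piMap fun i =>
      Topology.IsInducing.subtypeVal.comp (e i).toHomeomorph.isInducing
  let Φ : (∀ i, G i) →*
      Subgroup.centralizer (coordSubgroup μ ρ : Set (AutMP (Measure.infinitePi μ))) :=
    ((prodHom μ).comp φ).codRestrict _ fun g =>
      prodHom_mem_centralizer_iff.2 fun i => (e i (g i)).2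
  have hΦ : Topology.IsInducing Φ :=
    Topology.IsInducing.of_comp_iff Topology.IsInducing.subtypeVal |>.1
      ((isInducing_prodHom μ).comp hφ)
  have hbij : Function.Bijective Φ := by
    constructor
    · intro g h hgh
      have := prodHom_injective μ (congrArg Subtype.val hgh)
      funext i
      exact (e i).injective (Subtype.ext (congrFun this i))
    · rintro ⟨T, hT⟩
      obtain ⟨S, rfl⟩ := mem_range_prodHom_of_mem_centralizer hρ hT
      have hS := prodHom_mem_centralizer_iff.1 hT
      refine ⟨fun i => (e i).symm ⟨S i, hS i⟩, Subtype.ext (congrArg (prodHom μ) ?_)⟩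
      funext i
      exact congrArg Subtype.val ((e i).apply_symm_apply ⟨S i, hS i⟩)
  let H := (Equiv.ofBijective Φ hbij).toHomeomorphOfIsInducing hΦ
  exact ⟨{ MulEquiv.ofBijective Φ hbij with
    continuous_toFun := H.continuous
    continuous_invFun := H.symm.continuous }, fun g => rfl⟩

end Product

end AutMP

/-- A countable product of centralizer groups is a centralizer group. -/
theorem IsCentralizerGroup.pi {I : Type*} [Countable I] {G : I → Type*} [∀ i, Group (G i)]
    [∀ i, TopologicalSpace (G i)] (h : ∀ i, IsCentralizerGroup (G i)) :
    IsCentralizerGroup (∀ i, G i) := by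
  have : ∀ i, IsTopologicalGroup (G i) := fun i => (h i).1
  have : ∀ i, PolishSpace (G i) := fun i => (h i).2.1
  refine ⟨inferInstance, inferInstance, ?_⟩
  choose X mX sX μ pμ Λ gΛ cΛ ρ hρ e using fun i => (h i).2.2
  -- The definition asks for a space and a group in `Type`, while `I` may live in any universe.
  let J := Shrink.{0} I
  let r : J ≃ I := (equivShrink.{0} I).symm
  have : Countable J := r.injective.countable
  let ρ' : ∀ j : J, Λ (r j) →* AutMP (μ (r j)) := fun j => ρ (r j)
  obtain ⟨E, -⟩ := AutMP.exists_continuousMulEquiv_centralizer (ρ := ρ') (fun j => hρ (r j))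
    (G := fun j => G (r j)) fun j => (e (r j)).some
  refine ⟨∀ j, X (r j), inferInstance, inferInstance, Measure.infinitePi fun j => μ (r j),
    inferInstance, AutMP.coordSubgroup (fun j => μ (r j)) ρ', inferInstance,
    AutMP.countable_coordSubgroup, (AutMP.coordSubgroup (fun j => μ (r j)) ρ').subtype,
    AutMP.isErgodicAction_coordSubgroup fun j => hρ (r j), ?_⟩
  have hrange : Set.range (AutMP.coordSubgroup (fun j => μ (r j)) ρ').subtype =
      AutMP.coordSubgroup (fun j => μ (r j)) ρ' := Subtype.range_coe
  generalize Set.range (AutMP.coordSubgroup (fun j => μ (r j)) ρ').subtype = R at hrange ⊢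
  subst hrange
  exact ⟨(ContinuousMulEquiv.piReindex r G).trans E⟩

/-- A countable product of centralizer groups is a centralizer group. Moreover, given realizations
of the `G i` as centralizers of ergodic actions `Λ i ↷ (X i, μ i)`, the product is the centralizer
of the countable ergodic group generated by the `Λ i` acting in their own coordinates of the
product space, with `g` acting as the product of the automorphisms given by the `g i`. -/
theorem mainTheorem6 {I : Type*} [Countable I] (G : I → Type*)
    [∀ i, Group (G i)] [∀ i, TopologicalSpace (G i)] :
    ((∀ i, IsCentralizerGroup (G i)) → IsCentralizerGroup (∀ i, G i)) ∧
    (∀ (X : I → Type*) [∀ i, MeasurableSpace (X i)] [∀ i, StandardBorelSpace (X i)]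
      (μ : ∀ i, Measure (X i)) [∀ i, IsProbabilityMeasure (μ i)]
      (Λ : I → Type*) [∀ i, Group (Λ i)] [∀ i, Countable (Λ i)]
      (ρ : ∀ i, Λ i →* AutMP (μ i)) (_ : ∀ i, AutMP.IsErgodicAction (ρ i))
      (e : ∀ i, G i ≃ₜ* Subgroup.centralizer (Set.range (ρ i))),
      StandardBorelSpace (∀ i, X i) ∧
      Countable (AutMP.coordSubgroup μ ρ) ∧
      AutMP.IsErgodicAction (AutMP.coordSubgroup μ ρ).subtype ∧
      ∃ E : (∀ i, G i) ≃ₜ*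
          Subgroup.centralizer (AutMP.coordSubgroup μ ρ : Set (AutMP (Measure.infinitePi μ))),
        ∀ g : ∀ i, G i,
          (E g : AutMP (Measure.infinitePi μ)) =
            AutMP.prodHom μ (fun i => (e i (g i) : AutMP (μ i)))) := by
  exact ⟨IsCentralizerGroup.pi, fun X _ _ μ _ Λ _ _ ρ hρ e =>
    ⟨inferInstance, AutMP.countable_coordSubgroup, AutMP.isErgodicAction_coordSubgroup hρ,
      AutMP.exists_continuousMulEquiv_centralizer hρ e⟩⟩
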